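/- Let $\kappa<\lambda$ be regular cardinals, let $\mathcal C$ be a locally $\lambda$-presentable category, and let $(J,\iota)$ be a pointed endofunctor on $\mathcal C$, i.e. a functor $J:\mathcal C\to\mathcal C$ together with a natural transformation $\iota:\mathrm{id}_{\mathcal C}\Rightarrow J$. Let $\mathcal C^{(J,\iota)}$ be the category of $(J,\iota)$-algebras: its objects are pairs $(A,a)$ with $a:JA\to A$ a morphism in $\mathcal C$ such that $a\circ\iota_A=\mathrm{id}_A$, and its morphisms $(A,a)\to(B,b)$ are the morphisms $f:A\to B$ in $\mathcal C$ with $f\circ a=b\circ Jf$. Let $U:\mathcal C^{(J,\iota)}\to\mathcal C$, $(A,a)\mapsto A$, be the forgetful functor. Call a functor $F:\mathcal A\to\mathcal B$ *strongly $\lambda$-accessible* if $\mathcal A$ and $\mathcal B$ are $\lambda$-accessible categories, $F$ preserves colimits of small $\lambda$-filtered diagrams, and $F$ sends $\lambda$-presentable objects of $\mathcal A$ to $\lambda$-presentable objects of $\mathcal B$. Suppose that $J$ preserves colimits of small $\kappa$-filtered diagrams and is strongly $\lambda$-accessible. Then $U$ has a left adjoint $F$, and, writing $\mathbb T=(T,\eta,\mu)$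 with $T=UF$ for the monad on $\mathcal C$ induced by the adjunction $F\dashv U$: 1. The functor $T:\mathcal C\to\mathcal C$ preserves colimits of small $\kappa$-filtered diagrams and is strongly $\lambda$-accessible. 2. $\mathcal C^{(J,\iota)}$ is a locally $\lambda$-presentable category. 3. The forgetful functor $U:\mathcal C^{(J,\iota)}\to\mathcal C$ is strongly $\lambda$-accessible. -/

import Mathlib

open CategoryTheory

universe w v₁ v₂ u₁ u₂

/-- A functor `F : C ⥤ D` is strongly `κ`-accessible if `C` and `D` are `κ`-accessible categories,
`F` preserves colimits of small `κ`-filtered diagrams, and `F` sends `κ`-presentable objects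
to `κ`-presentable objects. Small means relative to the universe `w` of `κ`. -/
structure IsStronglyCardinalAccessible {C : Type u₁} [Category.{v₁} C] {D : Type u₂}
    [Category.{v₂} D] (F : C ⥤ D) (κ : Cardinal.{w}) [Fact κ.IsRegular] : Prop where
  source : IsCardinalAccessibleCategory C κ
  target : IsCardinalAccessibleCategory D κ
  preserves : F.IsCardinalAccessible κ
  presentable : ∀ X : C, IsCardinalPresentable X κ → IsCardinalPresentable (F.obj X) κ

/-- The property of an algebra `a : J A ⟶ A` of the endofunctor `J` that it is an algebra for
the pointed endofunctor `(J, ι)`, i.e. that the unit law `a ∘ ι_A = id_A` holds. -/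
def isPointedAlgebra {C : Type u₁} [Category.{v₁} C] (J : C ⥤ C) (ι : 𝟭 C ⟶ J) :
    ObjectProperty (Endofunctor.Algebra J) :=
  fun A => ι.app A.a ≫ A.str = 𝟙 A.a

/-- The category of algebras for the pointed endofunctor `(J, ι)`: the objects are pairs
`(A, a : J A ⟶ A)` with `a ∘ ι_A = id_A`, and the morphisms are the morphisms in `C` that commute
with the structure morphisms. -/
abbrev PointedAlgebra {C : Type u₁} [Category.{v₁} C] (J : C ⥤ C) (ι : 𝟭 C ⟶ J) :=
  (isPointedAlgebra J ι).FullSubcategory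

/-- The forgetful functor `(A, a) ↦ A` from `(J, ι)`-algebras to `C`. -/
abbrev PointedAlgebra.forget {C : Type u₁} [Category.{v₁} C] (J : C ⥤ C) (ι : 𝟭 C ⟶ J) :
    PointedAlgebra J ι ⥤ C :=
  (isPointedAlgebra J ι).ι ⋙ Endofunctor.Algebra.forget J

/-! A pointed algebra is an object `J A ⟶ D` of `Comma J (𝟭 C)` whose composite `A ⟶ J A ⟶ D` with
the unit is invertible. Tested on a small strong generator of presentable objects, invertibility
becomes orthogonality to a small set of morphisms between presentable objects. Hence algebras are
reflective in a cocomplete category: they have colimits, and `U` has a left adjoint `F`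
(`isRightAdjoint_toComma`). Because `J` preserves κ-filtered colimits, `U` creates them, so `T = UF`
preserves them and `F` preserves λ-presentable objects.

The hard point is that `U` preserves λ-presentable objects. It suffices that each algebra `A` is a
λ-filtered colimit of algebras with λ-presentable carrier: a λ-presentable algebra is then a retract
of one of these. Write the carrier as a λ-directed colimit of λ-presentable `X i`. Since `J (X i)`
is λ-presentable, the structure of `A` restricts to maps `J (X i) ⟶ X (s i)`, natural after passing
to a later index. Along a κ-sequence of indices closed under these passages they glue to an algebra
structure on the colimit, because `J` preserves that colimit; its carrier is λ-presentable because κ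
< λ. Such sequences have upper bounds, built by transfinite recursion, and their algebras have
colimit `A`. -/

/-! ### Colimits and presentable objects in the comma category -/

namespace CategoryTheory.Comma

open Limits

variable {A : Type u₁} [Category.{v₁} A] {T : Type u₂} [Category.{v₂} T]

section

variable {K : Type*} [Category* K] {L : A ⥤ T} (D : K ⥤ Comma L (𝟭 T))
  [HasColimit (D ⋙ fst _ _)] [HasColimit ((D ⋙ fst _ _) ⋙ L)] [HasColimit (D ⋙ snd _ _)]

/-- The map on colimits of the sources and targets induced by a diagram of objects
`L X ⟶ Y` of the comma category. -/
noncomputable def colimHom :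
    colimit ((D ⋙ fst _ _) ⋙ L) ⟶ colimit (D ⋙ snd _ _) :=
  colimit.desc _ (Cocone.mk _
    { app k := (D.obj k).hom ≫ colimit.ι (D ⋙ snd _ _) k
      naturality j k f := by
        have h₁ : (D.map f).right ≫ colimit.ι (D ⋙ snd _ _) k = colimit.ι (D ⋙ snd _ _) j :=
          colimit.w (D ⋙ snd _ _) f
        have h₂ : L.map (D.map f).left ≫ (D.obj k).hom = (D.obj j).hom ≫ (D.map f).right :=
          (D.map f).w
        change L.map (D.map f).left ≫ (D.obj k).hom ≫ _ = (_ ≫ _) ≫ 𝟙 _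
        rw [Category.comp_id, ← h₁, ← Category.assoc, h₂, Category.assoc] })

omit [HasColimit (D ⋙ fst _ _)] in
@[simp]
lemma ι_colimHom (k : K) :
    colimit.ι ((D ⋙ fst _ _) ⋙ L) k ≫ colimHom D =
      (D.obj k).hom ≫ colimit.ι (D ⋙ snd _ _) k :=
  colimit.ι_desc _ _

variable [HasPushout (colimit.post (D ⋙ fst _ _) L) (colimHom D)]

/-- The colimit cocone of a diagram in `Comma L (𝟭 T)`, obtained as a pushout. -/
noncomputable def pushoutCocone : Cocone D where
  pt :=
    { left := colimit (D ⋙ fst _ _)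
      right := pushout (colimit.post (D ⋙ fst _ _) L) (colimHom D)
      hom := pushout.inl _ _ }
  ι :=
    { app k :=
        { left := colimit.ι (D ⋙ fst _ _) k
          right := colimit.ι (D ⋙ snd _ _) k ≫ pushout.inr _ _
          w := by
            have h : colimit.ι ((D ⋙ fst _ _) ⋙ L) k ≫ colimit.post (D ⋙ fst _ _) L =
              L.map (colimit.ι (D ⋙ fst _ _) k) := colimit.ι_post (D ⋙ fst _ _) L k
            refine (h =≫ pushout.inl _ _).symm.trans ?_
            rw [Category.assoc, pushout.condition, reassoc_of% ι_colimHom D k]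
            rfl }
      naturality j k f := by
        have h₁ := colimit.w (D ⋙ fst _ _) f
        have h₂ := colimit.w (D ⋙ snd _ _) f
        ext
        · exact h₁.trans (Category.comp_id _).symm
        · refine Eq.trans ?_ (Category.comp_id _).symm
          exact (Category.assoc _ _ _).symm.trans (h₂ =≫ _) }

/-- The second component of the morphism from `pushoutCocone D` to a cocone. -/
noncomputable def pushoutCoconeDescRight (s : Cocone D) :
    pushout (colimit.post (D ⋙ fst _ _) L) (colimHom D) ⟶ s.pt.right :=
  pushout.desc (L.map (colimit.desc _ ((fst _ _).mapCocone s)) ≫ s.pt.hom)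
    (colimit.desc _ ((snd _ _).mapCocone s)) (by
      apply colimit.hom_ext
      intro k
      have h : L.map (s.ι.app k).left ≫ s.pt.hom = (D.obj k).hom ≫ (s.ι.app k).right :=
        (s.ι.app k).w
      have h₁ : colimit.ι (D ⋙ fst _ _) k ≫ colimit.desc _ ((fst _ _).mapCocone s) =
        (s.ι.app k).left := colimit.ι_desc _ _
      have h₂ : colimit.ι (D ⋙ snd _ _) k ≫ colimit.desc _ ((snd _ _).mapCocone s) =
        (s.ι.app k).right := colimit.ι_desc _ _
      have h₃ : colimit.ι ((D ⋙ fst _ _) ⋙ L) k ≫ colimit.post (D ⋙ fst _ _) L =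
        L.map (colimit.ι (D ⋙ fst _ _) k) := colimit.ι_post (D ⋙ fst _ _) L k
      rw [reassoc_of% h₃, ← L.map_comp_assoc, h₁, reassoc_of% ι_colimHom D k, h₂]
      exact h)

@[simp]
lemma inl_pushoutCoconeDescRight (s : Cocone D) :
    pushout.inl _ _ ≫ pushoutCoconeDescRight D s =
      L.map (colimit.desc _ ((fst _ _).mapCocone s)) ≫ s.pt.hom :=
  pushout.inl_desc _ _ _

@[simp]
lemma inr_pushoutCoconeDescRight (s : Cocone D) :
    pushout.inr _ _ ≫ pushoutCoconeDescRight D s =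
      colimit.desc _ ((snd _ _).mapCocone s) :=
  pushout.inr_desc _ _ _

/-- The cocone `pushoutCocone D` is a colimit cocone. -/
noncomputable def isColimitPushoutCocone : IsColimit (pushoutCocone D) where
  desc s :=
    { left := colimit.desc _ ((fst _ _).mapCocone s)
      right := pushoutCoconeDescRight D s
      w := (inl_pushoutCoconeDescRight D s).symm }
  fac s k := by
    ext
    · exact colimit.ι_desc _ _
    · refine (Category.assoc _ _ _).trans ?_
      exact (whisker_eq _ (inr_pushoutCoconeDescRight D s)).trans (colimit.ι_desc _ _)
  uniq s m hm := by
    have hl : m.left = colimit.desc _ ((fst _ _).mapCocone s) := by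
      apply colimit.hom_ext
      intro k
      have := congr_arg CommaMorphism.left (hm k)
      rw [colimit.ι_desc]
      exact this
    ext
    · exact hl
    · apply pushout.hom_ext
      · rw [inl_pushoutCoconeDescRight, ← hl]
        exact m.w.symm
      · apply colimit.hom_ext
        intro k
        have := congr_arg CommaMorphism.right (hm k)
        rw [inr_pushoutCoconeDescRight, colimit.ι_desc]
        exact (Category.assoc _ _ _).symm.trans this

end

lemma hasColimitsOfSize_id_right (L : A ⥤ T) [HasColimitsOfSize.{w, w} A]
    [HasColimitsOfSize.{w, w} T] : HasColimitsOfSize.{w, w} (Comma L (𝟭 T)) where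
  has_colimits_of_shape K _ :=
    { has_colimit D := by
        have := hasColimitsOfSizeShrink.{0, 0, w, w} T
        exact ⟨⟨⟨_, isColimitPushoutCocone D⟩⟩⟩ }

instance (L : A ⥤ T) [LocallySmall.{w} A] [LocallySmall.{w} T] :
    LocallySmall.{w} (Comma L (𝟭 T)) where
  hom_small X Y := small_of_injective
    (f := fun (φ : X ⟶ Y) ↦ (⟨φ.left, φ.right⟩ : (X.left ⟶ Y.left) × (X.right ⟶ Y.right)))
    (fun φ ψ h ↦ by
      ext
      · exact (Prod.ext_iff.1 h).1
      · exact (Prod.ext_iff.1 h).2)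

section

variable (L : A ⥤ T)

/-- The functor `X ↦ (L X ⟶ L X)` is left adjoint to the first projection. -/
def homEquivFst (X : A) (D : Comma L (𝟭 T)) :
    ((⟨X, L.obj X, 𝟙 _⟩ : Comma L (𝟭 T)) ⟶ D) ≃ (X ⟶ D.left) where
  toFun φ := φ.left
  invFun f := { left := f, right := L.map f ≫ D.hom }
  left_inv φ := by
    ext
    · rfl
    · exact φ.w.trans (Category.id_comp _)
  right_inv _ := rfl

variable [HasInitial A] [HasBinaryCoproducts T]

/-- The functor `Z ↦ (L ∅ ⟶ L ∅ ⨿ Z)` is left adjoint to the second projection. -/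
noncomputable def homEquivSnd (Z : T) (D : Comma L (𝟭 T)) :
    ((⟨⊥_ A, L.obj (⊥_ A) ⨿ Z, coprod.inl⟩ : Comma L (𝟭 T)) ⟶ D) ≃ (Z ⟶ D.right) where
  toFun φ := coprod.inr ≫ φ.right
  invFun f :=
    { left := initial.to _
      right := coprod.desc (L.map (initial.to _) ≫ D.hom) f
      w := (coprod.inl_desc _ _).symm }
  left_inv φ := by
    have h : initial.to _ = φ.left := Subsingleton.elim _ _
    refine CommaMorphism.ext h (coprod.hom_ext ?_ ?_)
    · refine (coprod.inl_desc _ _).trans ?_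
      rw [h]
      exact φ.w
    · exact coprod.inr_desc _ _
  right_inv _ := coprod.inr_desc _ _

lemma homEquivSnd_comp (Z : T) {D D' : Comma L (𝟭 T)} (φ) (ψ : D ⟶ D') :
    homEquivSnd L Z D' (φ ≫ ψ) = homEquivSnd L Z D φ ≫ ψ.right := by
  simp [homEquivSnd]

end

section

variable (L : A ⥤ T) (κ : Cardinal.{w}) [Fact κ.IsRegular] [L.IsCardinalAccessible κ]
  [HasColimitsOfSize.{w, w} A] [HasColimitsOfSize.{w, w} T]

/-- When `L` preserves the colimit no pushout is needed: the colimit in the comma category is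
computed componentwise. -/
lemma isCardinalAccessible_fst : (fst L (𝟭 T)).IsCardinalAccessible κ where
  preservesColimitOfShape K _ _ :=
    { preservesColimit {D} := by
        have := L.preservesColimitsOfShape_of_isCardinalAccessible κ K
        exact preservesColimit_of_preserves_colimit_cocone
          (coconeOfPreservesIsColimit D (colimit.isColimit _) (colimit.isColimit _))
          (colimit.isColimit _) }

lemma isCardinalAccessible_snd : (snd L (𝟭 T)).IsCardinalAccessible κ where
  preservesColimitOfShape K _ _ :=
    { preservesColimit {D} := by
        have := L.preservesColimitsOfShape_of_isCardinalAccessible κ K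
        exact preservesColimit_of_preserves_colimit_cocone
          (coconeOfPreservesIsColimit D (colimit.isColimit _) (colimit.isColimit _))
          (colimit.isColimit _) }

lemma isCardinalPresentable_mk_id (X : A) [IsCardinalPresentable X κ] :
    IsCardinalPresentable (⟨X, L.obj X, 𝟙 _⟩ : Comma L (𝟭 T)) κ :=
  have := isCardinalAccessible_fst L κ
  (Adjunction.adjunctionOfEquivLeft (G := fst L (𝟭 T)) (homEquivFst L)
    (fun _ _ _ _ _ ↦ rfl)).isCardinalPresentable_leftAdjoint_obj κ X

lemma isCardinalPresentable_mk_inl [HasInitial A] [HasBinaryCoproducts T] (Z : T)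
    [IsCardinalPresentable Z κ] :
    IsCardinalPresentable
      (⟨⊥_ A, L.obj (⊥_ A) ⨿ Z, coprod.inl⟩ : Comma L (𝟭 T)) κ :=
  have := isCardinalAccessible_snd L κ
  (Adjunction.adjunctionOfEquivLeft (G := snd L (𝟭 T)) (homEquivSnd L)
    (fun Z _ _ ψ φ ↦ homEquivSnd_comp L Z φ ψ)).isCardinalPresentable_leftAdjoint_obj κ Z

end

end CategoryTheory.Comma

/-! ### Algebras as an orthogonality class -/

namespace PointedAlgebra

open Limits

variable {C : Type u₁} [Category.{v₁} C] {J : C ⥤ C} {ι : 𝟭 C ⟶ J}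

lemma unit_str (A : PointedAlgebra J ι) : ι.app A.obj.a ≫ A.obj.str = 𝟙 A.obj.a := A.property

/-- Constructor for objects of the category of `(J, ι)`-algebras. -/
abbrev mk (X : C) (a : J.obj X ⟶ X) (h : ι.app X ≫ a = 𝟙 X) : PointedAlgebra J ι :=
  ⟨⟨X, a⟩, h⟩

/-- Constructor for morphisms in the category of `(J, ι)`-algebras. -/
abbrev homMk {A B : PointedAlgebra J ι} (f : A.obj.a ⟶ B.obj.a)
    (h : J.map f ≫ B.obj.str = A.obj.str ≫ f) : A ⟶ B :=
  ObjectProperty.homMk ⟨f, h⟩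

lemma hom_ext {A B : PointedAlgebra J ι} {f g : A ⟶ B} (h : f.hom.f = g.hom.f) : f = g :=
  ObjectProperty.hom_ext _ (Endofunctor.Algebra.Hom.ext h)

variable (J ι) in
/-- The embedding of `(J, ι)`-algebras in the category of arrows `J X ⟶ Y`. -/
def toComma : PointedAlgebra J ι ⥤ Comma J (𝟭 C) where
  obj A := ⟨A.obj.a, A.obj.a, A.obj.str⟩
  map f := { left := f.hom.f, right := f.hom.f, w := f.hom.h }

/-- Precompose the square with `ι` and use naturality and both unit laws. This is what makes
`toComma` full. -/
lemma eq_of_map_comp_str {A B : PointedAlgebra J ι} {f g : A.obj.a ⟶ B.obj.a}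
    (h : J.map f ≫ B.obj.str = A.obj.str ≫ g) : f = g := by
  have hf : f ≫ ι.app B.obj.a = ι.app A.obj.a ≫ J.map f := ι.naturality f
  have h₁ : f = f ≫ ι.app B.obj.a ≫ B.obj.str := by rw [unit_str, Category.comp_id]
  rw [h₁, reassoc_of% hf, h, reassoc_of% A.unit_str]

variable (J ι) in
/-- The functor `toComma J ι` is fully faithful. -/
def fullyFaithfulToComma : (toComma J ι).FullyFaithful where
  preimage {A B} φ := homMk φ.left (φ.w.trans (by
    have h : φ.left = φ.right := eq_of_map_comp_str φ.w
    rw [h]; rfl))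
  map_preimage φ := by
    ext
    · rfl
    · exact eq_of_map_comp_str φ.w
  preimage_map _ := rfl

instance : (toComma J ι).Full := (fullyFaithfulToComma J ι).full

instance : (toComma J ι).Faithful := (fullyFaithfulToComma J ι).faithful

instance : (forget J ι).Faithful where
  map_injective h := hom_ext h

lemma essImage_toComma (D : Comma J (𝟭 C)) (h : IsIso (ι.app D.left ≫ D.hom)) :
    (toComma J ι).essImage D := by
  let e : D.left ≅ D.right := @asIso _ _ _ _ (ι.app D.left ≫ D.hom) h
  have he : ι.app D.left ≫ D.hom = e.hom := rfl
  refine ⟨mk D.left (D.hom ≫ e.inv) ?_, ⟨Comma.isoMk (Iso.refl _) e ?_⟩⟩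
  · refine (Category.assoc _ _ _).symm.trans ?_
    rw [he]
    exact e.hom_inv_id
  · change J.map (𝟙 _) ≫ D.hom = (D.hom ≫ e.inv) ≫ e.hom
    exact Eq.trans (by simp) (Category.assoc _ _ _).symm

variable [HasInitial C] [HasBinaryCoproducts C]

variable (J ι) in
/-- The morphisms of the comma category corresponding to the components of `ι` on a family
of objects, by adjunction. -/
noncomputable def unitArrows (S : ObjectProperty C) : MorphismProperty (Comma J (𝟭 C)) :=
  MorphismProperty.ofHoms (fun Z : Subtype S ↦
    (Comma.homEquivSnd J Z.1 (⟨Z.1, J.obj Z.1, 𝟙 _⟩ : Comma J (𝟭 C))).symm (ι.app Z.1))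

/-- Under the two adjunctions, precomposition with a unit arrow becomes postcomposition with `D.left
⟶ J D.left ⟶ D.right`; locality is therefore bijectivity of the latter on maps out of `Z`. -/
lemma unitArrows_comp (Z : C) (D : Comma J (𝟭 C)) (f : Z ⟶ D.left) :
    (Comma.homEquivSnd J Z (⟨Z, J.obj Z, 𝟙 _⟩ : Comma J (𝟭 C))).symm (ι.app Z) ≫
      (Comma.homEquivFst J Z D).symm f =
    (Comma.homEquivSnd J Z D).symm (f ≫ ι.app D.left ≫ D.hom) := by
  apply (Comma.homEquivSnd J Z D).injective
  rw [Comma.homEquivSnd_comp, Equiv.apply_symm_apply, Equiv.apply_symm_apply]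
  have h : f ≫ ι.app D.left = ι.app Z ≫ J.map f := ι.naturality f
  refine Eq.trans ?_ ((Category.assoc _ _ _).symm.trans (h =≫ D.hom)).symm
  exact (Category.assoc _ _ _).symm

lemma isLocal_unitArrows_iff (S : ObjectProperty C) (D : Comma J (𝟭 C)) :
    (unitArrows J ι S).isLocal D ↔ ∀ (Z : C) (_ : S Z),
      Function.Bijective (fun f : Z ⟶ D.left ↦ f ≫ ι.app D.left ≫ D.hom) := by
  have key (Z : C) : Function.Bijective (fun f : Z ⟶ D.left ↦ f ≫ ι.app D.left ≫ D.hom) ↔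
      Function.Bijective (fun g : (⟨Z, J.obj Z, 𝟙 _⟩ : Comma J (𝟭 C)) ⟶ D ↦
        (Comma.homEquivSnd J Z (⟨Z, J.obj Z, 𝟙 _⟩ : Comma J (𝟭 C))).symm (ι.app Z) ≫ g) := by
    rw [← Function.Bijective.of_comp_iff _ (Comma.homEquivFst J Z D).symm.bijective,
      ← Function.Bijective.of_comp_iff' (Comma.homEquivSnd J Z D).symm.bijective]
    apply iff_of_eq
    congr 1
    ext1 f
    exact (unitArrows_comp Z D f).symm
  constructor
  · intro h Z hZ
    rw [key]
    exact h _ (MorphismProperty.ofHoms.mk (⟨Z, hZ⟩ : Subtype S))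
  · rintro h _ _ _ ⟨Z⟩
    exact (key Z.1).1 (h Z.1 Z.2)

lemma isLocal_toComma_obj (S : ObjectProperty C) (A : PointedAlgebra J ι) :
    (unitArrows J ι S).isLocal ((toComma J ι).obj A) := by
  rw [isLocal_unitArrows_iff]
  intro Z _
  have h : (fun f : Z ⟶ A.obj.a ↦ f ≫ ι.app A.obj.a ≫ A.obj.str) = id := by
    ext1 f
    refine (whisker_eq f A.unit_str).trans (Category.comp_id f)
  exact h ▸ Function.bijective_id

/-- Injectivity on maps from a separating family gives a monomorphism; surjectivity on maps from a
strong generator then makes it invertible. -/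
lemma isIso_of_isLocal_unitArrows {S : ObjectProperty C} (hS : S.IsStrongGenerator)
    (D : Comma J (𝟭 C)) (hD : (unitArrows J ι S).isLocal D) :
    IsIso (ι.app D.left ≫ D.hom) := by
  rw [isLocal_unitArrows_iff] at hD
  have : Mono (ι.app D.left ≫ D.hom) := ⟨fun {Z} f g h ↦
    hS.isSeparating _ _ (fun G hG k ↦ (hD G hG).1 (by
      change (k ≫ f) ≫ _ = (k ≫ g) ≫ _
      rw [Category.assoc, h, Category.assoc]))⟩
  exact hS.isIso_of_mono _ (fun G hG ↦ (hD G hG).2)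

end PointedAlgebra

/-! ### Reflectivity, cocompleteness and the free algebra functor -/

namespace PointedAlgebra

open Limits

variable {C : Type u₁} [Category.{v₁} C] (J : C ⥤ C) (ι : 𝟭 C ⟶ J)

lemma isRightAdjoint_toComma (κ : Cardinal.{w}) [Fact κ.IsRegular]
    [IsCardinalLocallyPresentable C κ] [J.IsCardinalAccessible κ] :
    (toComma J ι).IsRightAdjoint := by
  obtain ⟨S, _, hS⟩ := HasCardinalFilteredGenerator.exists_small_generator C κ
  have := hasColimitsOfSizeShrink.{0, 0, w, w} C
  have := Comma.hasColimitsOfSize_id_right.{w} J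
  let W := unitArrows J ι S
  have : MorphismProperty.IsSmall.{w} W := by
    dsimp only [W, unitArrows]; infer_instance
  have : W.isLocal.ι.IsRightAdjoint := by
    refine W.isRightAdjoint_ι_isLocal κ ?_
    rintro _ _ _ ⟨⟨Z, hZ⟩⟩
    have : IsCardinalPresentable Z κ := hS.le_isCardinalPresentable _ hZ
    exact ⟨Comma.isCardinalPresentable_mk_inl J κ Z, Comma.isCardinalPresentable_mk_id J κ Z⟩
  let F : PointedAlgebra J ι ⥤ W.isLocal.FullSubcategory :=
    W.isLocal.lift (toComma J ι) (isLocal_toComma_obj S)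
  have : F.EssSurj := ⟨fun D ↦ by
    obtain ⟨A, ⟨e⟩⟩ := essImage_toComma D.obj
      (isIso_of_isLocal_unitArrows hS.isStrongGenerator D.obj D.property)
    exact ⟨A, ⟨W.isLocal.isoMk e⟩⟩⟩
  have : F.IsEquivalence := { }
  exact inferInstanceAs (F ⋙ W.isLocal.ι).IsRightAdjoint

lemma hasColimitsOfSize (κ : Cardinal.{w}) [Fact κ.IsRegular]
    [IsCardinalLocallyPresentable C κ] [J.IsCardinalAccessible κ] :
    HasColimitsOfSize.{w, w} (PointedAlgebra J ι) := by
  have := isRightAdjoint_toComma J ι κ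
  have := Comma.hasColimitsOfSize_id_right.{w} J
  let : Reflective (toComma J ι) := ⟨_, Adjunction.ofIsRightAdjoint _⟩
  exact hasColimits_of_reflective (toComma J ι)

lemma isRightAdjoint_forget (κ : Cardinal.{w}) [Fact κ.IsRegular]
    [IsCardinalLocallyPresentable C κ] [J.IsCardinalAccessible κ] :
    (forget J ι).IsRightAdjoint := by
  have := isRightAdjoint_toComma J ι κ
  have : (Comma.fst J (𝟭 C)).IsRightAdjoint :=
    (Adjunction.adjunctionOfEquivLeft (G := Comma.fst J (𝟭 C)) (Comma.homEquivFst J)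
      (fun _ _ _ _ _ ↦ rfl)).isRightAdjoint
  exact inferInstanceAs (toComma J ι ⋙ Comma.fst J (𝟭 C)).IsRightAdjoint

end PointedAlgebra

/-! ### Colimits preserved by `J`, and presentability detected on carriers -/

namespace PointedAlgebra

open Limits

variable {C : Type u₁} [Category.{v₁} C] {J : C ⥤ C} {ι : 𝟭 C ⟶ J}

lemma map_comp_str {A B : PointedAlgebra J ι} (f : A ⟶ B) :
    J.map f.hom.f ≫ B.obj.str = A.obj.str ≫ f.hom.f :=
  f.hom.h

lemma map_comp_str_comp {A B : PointedAlgebra J ι} (f : A ⟶ B) {X : C} {x : A.obj.a ⟶ X}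
    {y : B.obj.a ⟶ X} (h : f.hom.f ≫ y = x) :
    J.map f.hom.f ≫ B.obj.str ≫ y = A.obj.str ≫ x := by
  rw [reassoc_of% map_comp_str f, h]

lemma map_comp_map_comp_str {A B E : PointedAlgebra J ι} (f : A ⟶ B) (g : A ⟶ E)
    {d : B.obj.a ⟶ E.obj.a} (h : f.hom.f ≫ d = g.hom.f) :
    J.map f.hom.f ≫ J.map d ≫ E.obj.str = J.map f.hom.f ≫ B.obj.str ≫ d := by
  rw [map_comp_str_comp f h, ← J.map_comp_assoc, h, map_comp_str]

lemma comp_unit_comp {A : PointedAlgebra J ι} {X : C} (x : A.obj.a ⟶ X) (m : J.obj X ⟶ X)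
    (h : J.map x ≫ m = A.obj.str ≫ x) : x ≫ ι.app X ≫ m = x := by
  have hx : x ≫ ι.app X = ι.app A.obj.a ≫ J.map x := ι.naturality x
  rw [reassoc_of% hx, h, reassoc_of% A.unit_str]

section

variable {K : Type*} [Category* K] {D : K ⥤ PointedAlgebra J ι}
  [PreservesColimit (D ⋙ forget J ι) J]

/-- The forgetful functor from `(J, ι)`-algebras reflects the colimits that `J` preserves. -/
noncomputable def isColimitOfForget {c : Cocone D} (hc : IsColimit ((forget J ι).mapCocone c)) :
    IsColimit c where
  desc s := homMk (hc.desc ((forget J ι).mapCocone s)) (by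
    apply (isColimitOfPreserves J hc).hom_ext
    intro k
    exact map_comp_map_comp_str (c.ι.app k) (s.ι.app k) (hc.fac _ k))
  fac s k := hom_ext (hc.fac _ k)
  uniq s m hm := hom_ext (hc.uniq ((forget J ι).mapCocone s) m.hom.f
    (fun k ↦ congr_arg (fun f ↦ f.hom.f) (hm k)))

section

variable {t : Cocone (D ⋙ forget J ι)} (ht : IsColimit t)

/-- The structure of algebra on a colimit that is preserved by `J`. -/
noncomputable def colimitStr : J.obj t.pt ⟶ t.pt :=
  (isColimitOfPreserves J ht).desc (Cocone.mk t.pt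
    { app k := (D.obj k).obj.str ≫ t.ι.app k
      naturality j k f := by
        exact (map_comp_str_comp (D.map f) (t.w f)).trans (Category.comp_id _).symm })

lemma map_ι_colimitStr (k : K) :
    J.map (t.ι.app k) ≫ colimitStr ht = (D.obj k).obj.str ≫ t.ι.app k :=
  (isColimitOfPreserves J ht).fac _ k

/-- The lift to `(J, ι)`-algebras of a colimit cocone that is preserved by `J`. -/
noncomputable def liftCocone : Cocone D where
  pt := mk t.pt (colimitStr ht) (ht.hom_ext (fun k ↦ by
    exact (comp_unit_comp (A := D.obj k) (t.ι.app k) _ (map_ι_colimitStr ht k)).trans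
      (Category.comp_id _).symm))
  ι :=
    { app k := homMk (t.ι.app k) (map_ι_colimitStr ht k)
      naturality j k f := hom_ext (t.ι.naturality f) }

end

lemma preservesColimit_forget [HasColimit (D ⋙ forget J ι)] :
    PreservesColimit D (forget J ι) :=
  preservesColimit_of_preserves_colimit_cocone
    (t := liftCocone (colimit.isColimit (D ⋙ forget J ι)))
    (isColimitOfForget (colimit.isColimit (D ⋙ forget J ι))) (colimit.isColimit _)

end

lemma isCardinalAccessible_forget (κ : Cardinal.{w}) [Fact κ.IsRegular]
    [J.IsCardinalAccessible κ] [HasCardinalFilteredColimits C κ] :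
    (forget J ι).IsCardinalAccessible κ where
  preservesColimitOfShape K _ _ :=
    { preservesColimit {D} := by
        have := J.preservesColimitsOfShape_of_isCardinalAccessible κ K
        have := HasCardinalFilteredColimits.hasColimitsOfShape C κ K
        exact preservesColimit_forget (D := D) }

/-- Presentability of the carrier factors a map through some stage. There the factorization need not
be an algebra morphism, but the two sides of the square, maps out of `J A`, agree in the colimit;
presentability of `J A` makes them agree at a later stage. -/
lemma isCardinalPresentable_of_forget (κ : Cardinal.{w}) [Fact κ.IsRegular]
    [J.IsCardinalAccessible κ] [HasCardinalFilteredColimits C κ] (A : PointedAlgebra J ι)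
    [IsCardinalPresentable A.obj.a κ] [IsCardinalPresentable (J.obj A.obj.a) κ] :
    IsCardinalPresentable A κ where
  preservesColimitOfShape K _ _ :=
    ⟨fun {D} ↦ ⟨fun {c} hc ↦ ⟨by
      have := isFiltered_of_isCardinalFiltered K κ
      have := isCardinalAccessible_forget (ι := ι) κ
      have := (forget J ι).preservesColimitsOfShape_of_isCardinalAccessible κ K
      have hc' := isColimitOfPreserves (forget J ι) hc
      refine Types.FilteredColimit.isColimitOf' _ _ (fun (f : A ⟶ c.pt) ↦ ?_)
        (fun k (f : A ⟶ D.obj k) (g : A ⟶ D.obj k) h ↦ ?_)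
      · obtain ⟨i, (x : A.obj.a ⟶ (D.obj i).obj.a), hx⟩ :=
          IsCardinalPresentable.exists_hom_of_isColimit κ hc' (X := A.obj.a) f.hom.f
        replace hx : x ≫ (c.ι.app i).hom.f = f.hom.f := hx
        have h₁ : J.map (c.ι.app i).hom.f ≫ c.pt.obj.str =
          (D.obj i).obj.str ≫ (c.ι.app i).hom.f := map_comp_str _
        have h₂ : J.map f.hom.f ≫ c.pt.obj.str = A.obj.str ≫ f.hom.f :=
          map_comp_str _
        obtain ⟨j, u, hu⟩ := IsCardinalPresentable.exists_eq_of_isColimit' κ hc'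
          (X := J.obj A.obj.a) (i := i) (J.map x ≫ (D.obj i).obj.str) (A.obj.str ≫ x) (by
            change (J.map x ≫ (D.obj i).obj.str) ≫ (c.ι.app i).hom.f =
              (A.obj.str ≫ x) ≫ (c.ι.app i).hom.f
            rw [Category.assoc, Category.assoc, hx, ← h₁, ← J.map_comp_assoc, hx, h₂])
        replace hu : (J.map x ≫ (D.obj i).obj.str) ≫ (D.map u).hom.f =
          (A.obj.str ≫ x) ≫ (D.map u).hom.f := hu
        have h₃ : J.map (D.map u).hom.f ≫ (D.obj j).obj.str =
          (D.obj i).obj.str ≫ (D.map u).hom.f := map_comp_str _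
        have h₄ : (D.map u).hom.f ≫ (c.ι.app j).hom.f = (c.ι.app i).hom.f :=
          congr_arg (fun f ↦ f.hom.f) (c.w u)
        refine ⟨j, (homMk (x ≫ (D.map u).hom.f) (by
          rw [J.map_comp, Category.assoc, h₃]
          simpa using hu) : A ⟶ D.obj j), hom_ext ?_⟩
        exact (((Category.assoc _ _ _).trans (whisker_eq x h₄)).trans hx).symm
      · replace h : f ≫ c.ι.app k = g ≫ c.ι.app k := h
        obtain ⟨j, u, hu⟩ := IsCardinalPresentable.exists_eq_of_isColimit' κ hc'
          (X := A.obj.a) (i := k) f.hom.f g.hom.f (congr_arg (fun f ↦ f.hom.f) h)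
        exact ⟨j, u, hom_ext hu⟩⟩⟩⟩

end PointedAlgebra

/-! ### Approximating the structure morphism on a presentation of the carrier -/

namespace PointedAlgebra

open Limits

variable {C : Type u₁} [Category.{v₁} C] {J : C ⥤ C} {ι : 𝟭 C ⟶ J}

/-- Given a presentation of the carrier of a `(J, ι)`-algebra as a colimit indexed by a partially
ordered set, this structure contains approximations `J X i ⟶ X (s i)` of the structure morphism,
which satisfy the unit law and are natural after passing to `t i j`. -/
structure StrApprox {A : PointedAlgebra J ι} {I : Type w} [PartialOrder I]
    (p : ColimitPresentation I A.obj.a) where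
  /-- the index where the structure morphism on `X i` takes values -/
  s : I → I
  le_s (i : I) : i ≤ s i
  /-- the approximation of the structure morphism -/
  str (i : I) : J.obj (p.diag.obj i) ⟶ p.diag.obj (s i)
  str_comp_ι (i : I) : str i ≫ p.ι.app (s i) = J.map (p.ι.app i) ≫ A.obj.str
  unit_str (i : I) : ι.app (p.diag.obj i) ≫ str i = p.diag.map (homOfLE (le_s i))
  /-- the index where naturality holds -/
  t : I → I → I
  le_t_left (i j : I) : s i ≤ t i j
  le_t_right (i j : I) : s j ≤ t i j
  naturality {i j : I} (h : i ≤ j) :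
    J.map (p.diag.map (homOfLE h)) ≫ str j ≫ p.diag.map (homOfLE (le_t_right i j)) =
      str i ≫ p.diag.map (homOfLE (le_t_left i j))

section

variable {A : PointedAlgebra J ι} {I : Type w} [PartialOrder I]
    (p : ColimitPresentation I A.obj.a) (κ : Cardinal.{w}) [Fact κ.IsRegular]
    [IsCardinalFiltered I κ]

/-- A factorization exists since `J (X i)` is presentable. The unit law holds in `A`, hence at a
later index since `X i` is presentable. -/
lemma exists_approx_str (i : I) [IsCardinalPresentable (p.diag.obj i) κ]
    [IsCardinalPresentable (J.obj (p.diag.obj i)) κ] :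
    ∃ (j : I) (h : i ≤ j) (f : J.obj (p.diag.obj i) ⟶ p.diag.obj j),
      f ≫ p.ι.app j = J.map (p.ι.app i) ≫ A.obj.str ∧
        ι.app (p.diag.obj i) ≫ f = p.diag.map (homOfLE h) := by
  have := isFiltered_of_isCardinalFiltered I κ
  obtain ⟨j, f, hf⟩ := IsCardinalPresentable.exists_hom_of_isColimit κ p.isColimit
    (J.map (p.ι.app i) ≫ A.obj.str)
  replace hf : f ≫ p.ι.app j = J.map (p.ι.app i) ≫ A.obj.str := hf
  have hι : p.ι.app i ≫ ι.app A.obj.a = ι.app (p.diag.obj i) ≫ J.map (p.ι.app i) :=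
    ι.naturality (p.ι.app i)
  obtain ⟨k, u, v, huv⟩ := IsCardinalPresentable.exists_eq_of_isColimit κ p.isColimit
    (X := p.diag.obj i) (𝟙 (p.diag.obj i)) (ι.app (p.diag.obj i) ≫ f) (by
      change 𝟙 _ ≫ p.ι.app i = (ι.app (p.diag.obj i) ≫ f) ≫ p.ι.app j
      have : (ι.app (p.diag.obj i) ≫ f) ≫ p.ι.app j =
        ι.app (p.diag.obj i) ≫ f ≫ p.ι.app j := Category.assoc _ _ _
      rw [this, hf, ← reassoc_of% hι, A.unit_str, Category.id_comp]
      exact (Category.comp_id _).symm)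
  refine ⟨k, leOfHom u, f ≫ p.diag.map v, ?_, ?_⟩
  · rw [Category.assoc, p.w, hf]
  · refine (Category.assoc _ _ _).symm.trans (huv.symm.trans ?_)
    exact Category.id_comp _

lemma exists_approx_naturality {i j k l : I} (h : i ≤ j)
    [IsCardinalPresentable (J.obj (p.diag.obj i)) κ]
    (f : J.obj (p.diag.obj i) ⟶ p.diag.obj k) (g : J.obj (p.diag.obj j) ⟶ p.diag.obj l)
    (hf : f ≫ p.ι.app k = J.map (p.ι.app i) ≫ A.obj.str)
    (hg : g ≫ p.ι.app l = J.map (p.ι.app j) ≫ A.obj.str) :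
    ∃ (m : I) (hk : k ≤ m) (hl : l ≤ m),
      J.map (p.diag.map (homOfLE h)) ≫ g ≫ p.diag.map (homOfLE hl) =
        f ≫ p.diag.map (homOfLE hk) := by
  obtain ⟨m, u, v, huv⟩ := IsCardinalPresentable.exists_eq_of_isColimit κ p.isColimit
    (X := J.obj (p.diag.obj i)) f (J.map (p.diag.map (homOfLE h)) ≫ g) (by
      change f ≫ p.ι.app k = (J.map (p.diag.map (homOfLE h)) ≫ g) ≫ p.ι.app l
      rw [Category.assoc, hf, hg, ← J.map_comp_assoc, p.w])
  exact ⟨m, leOfHom u, leOfHom v, ((Category.assoc _ _ _).symm.trans huv.symm)⟩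

lemma nonempty_strApprox (h₁ : ∀ i, IsCardinalPresentable (p.diag.obj i) κ)
    (h₂ : ∀ i, IsCardinalPresentable (J.obj (p.diag.obj i)) κ) :
    Nonempty (StrApprox p) := by
  have := isFiltered_of_isCardinalFiltered I κ
  choose s le_s str hs₁ hs₂ using fun i ↦ exists_approx_str p κ i
  have H (i j : I) : ∃ (m : I) (hi : s i ≤ m) (hj : s j ≤ m), ∀ (h : i ≤ j),
      J.map (p.diag.map (homOfLE h)) ≫ str j ≫ p.diag.map (homOfLE hj) =
        str i ≫ p.diag.map (homOfLE hi) := by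
    by_cases h : i ≤ j
    · obtain ⟨m, hi, hj, hm⟩ := exists_approx_naturality p κ h (str i) (str j) (hs₁ i) (hs₁ j)
      exact ⟨m, hi, hj, fun _ ↦ hm⟩
    -- Naturality is vacuous here, so any upper bound serves; this keeps `t` total.
    · exact ⟨IsFiltered.max (s i) (s j), leOfHom (IsFiltered.leftToMax _ _),
        leOfHom (IsFiltered.rightToMax _ _), fun h' ↦ (h h').elim⟩
  choose t ht₁ ht₂ ht₃ using H
  exact ⟨{
    s := s, le_s := le_s, str := str, str_comp_ι := hs₁, unit_str := hs₂, t := t,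
    le_t_left := ht₁, le_t_right := ht₂, naturality h := ht₃ _ _ h }⟩

end

/-! ### Chains of indices and the algebras they carry -/

namespace StrApprox

variable {A : PointedAlgebra J ι} {I : Type w} [PartialOrder I]
    {p : ColimitPresentation I A.obj.a} (S : StrApprox p)
    (O : Type w) [LinearOrder O]

/-- An increasing family of indices that is closed under the operation `t`. -/
structure Chain where
  /-- the underlying function -/
  toFun : O → I
  mono {a b : O} (h : a ≤ b) : toFun a ≤ toFun b
  t_le {a b c : O} (hac : a < c) (hbc : b < c) : S.t (toFun a) (toFun b) ≤ toFun c

namespace Chain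

variable {S O} (f g k : S.Chain O)

lemma s_le {a b : O} (h : a < b) : S.s (f.toFun a) ≤ f.toFun b :=
  (S.le_t_left _ _).trans (f.t_le h h)

lemma monotone : Monotone f.toFun := fun _ _ h ↦ f.mono h

/-- The diagram attached to a chain. -/
abbrev diag : O ⥤ C := f.monotone.functor ⋙ p.diag

variable [HasColimitsOfShape O C]

/-- The colimit of the diagram attached to a chain. -/
noncomputable def pt : C := colimit f.diag

/-- The inclusions in the colimit attached to a chain. -/
noncomputable def inj (a : O) : p.diag.obj (f.toFun a) ⟶ f.pt := colimit.ι f.diag a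

lemma map_comp_inj {a b : O} (h : a ≤ b) :
    p.diag.map (homOfLE (f.mono h)) ≫ f.inj b = f.inj a :=
  colimit.w f.diag (homOfLE h)

/-- The map from `X i` to the colimit attached to a chain that goes beyond `i`. -/
noncomputable def of (i : I) (h : ∃ a, i ≤ f.toFun a) : p.diag.obj i ⟶ f.pt :=
  p.diag.map (homOfLE h.choose_spec) ≫ f.inj h.choose

/-- The chosen index in `of` is immaterial: compare both indices with their maximum. -/
lemma of_eq {i : I} {a : O} (h : i ≤ f.toFun a) :
    f.of i ⟨a, h⟩ = p.diag.map (homOfLE h) ≫ f.inj a := by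
  have key (b c : O) (hb : i ≤ f.toFun b) (hbc : b ≤ c) :
      p.diag.map (homOfLE hb) ≫ f.inj b =
        p.diag.map (homOfLE (hb.trans (f.mono hbc))) ≫ f.inj c := by
    rw [← f.map_comp_inj hbc, ← p.diag.map_comp_assoc]
    rfl
  have h' : ∃ a, i ≤ f.toFun a := ⟨a, h⟩
  exact (key _ _ h'.choose_spec (le_max_left _ a)).trans (key _ _ h (le_max_right _ a)).symm

lemma map_comp_of {i j : I} (h : i ≤ j) (hj : ∃ a, j ≤ f.toFun a) :
    p.diag.map (homOfLE h) ≫ f.of j hj = f.of i (hj.imp fun _ ↦ h.trans) := by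
  obtain ⟨a, ha⟩ := hj
  rw [of_eq f ha, of_eq f (h.trans ha), ← p.diag.map_comp_assoc]
  rfl

lemma of_toFun (a : O) : f.of (f.toFun a) ⟨a, le_rfl⟩ = f.inj a := by
  rw [of_eq f le_rfl]
  exact (p.diag.map_id _ =≫ _).trans (Category.id_comp _)

variable {f} in
lemma hom_ext {X : C} {x y : f.pt ⟶ X} (h : ∀ a, f.of (f.toFun a) ⟨a, le_rfl⟩ ≫ x =
    f.of (f.toFun a) ⟨a, le_rfl⟩ ≫ y) : x = y :=
  colimit.hom_ext (fun a ↦ by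
    have := h a
    rw [of_toFun] at this
    exact this)

/-- The map from the colimit attached to a chain induced by a compatible family of maps. -/
noncomputable def desc {X : C} (x : ∀ (i : I) (_ : ∃ a, i ≤ f.toFun a), p.diag.obj i ⟶ X)
    (hx : ∀ (i j : I) (h : i ≤ j) (hj : ∃ a, j ≤ f.toFun a),
      p.diag.map (homOfLE h) ≫ x j hj = x i (hj.imp fun _ ↦ h.trans)) : f.pt ⟶ X :=
  colimit.desc f.diag (Cocone.mk X
    { app a := x (f.toFun a) ⟨a, le_rfl⟩
      naturality _ b φ :=
        (hx _ _ (f.mono (leOfHom φ)) ⟨b, le_rfl⟩).trans (Category.comp_id _).symm })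

lemma of_comp_desc {X : C} (x : ∀ (i : I) (_ : ∃ a, i ≤ f.toFun a), p.diag.obj i ⟶ X)
    (hx : ∀ (i j : I) (h : i ≤ j) (hj : ∃ a, j ≤ f.toFun a),
      p.diag.map (homOfLE h) ≫ x j hj = x i (hj.imp fun _ ↦ h.trans))
    (i : I) (hi : ∃ a, i ≤ f.toFun a) : f.of i hi ≫ f.desc x hx = x i hi := by
  obtain ⟨a, ha⟩ := hi
  rw [of_eq f ha, Category.assoc]
  exact (whisker_eq (p.diag.map (homOfLE ha)) (colimit.ι_desc _ a)).trans
    (hx _ _ ha ⟨a, le_rfl⟩)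

/-- The map from the colimit attached to a chain to the carrier of the algebra. -/
noncomputable def toCarrier : f.pt ⟶ A.obj.a :=
  f.desc (fun i _ ↦ p.ι.app i) (fun _ _ _ _ ↦ p.w _)

lemma of_comp_toCarrier (i : I) (hi : ∃ a, i ≤ f.toFun a) :
    f.of i hi ≫ f.toCarrier = p.ι.app i :=
  f.of_comp_desc _ _ i hi

variable {f g k} in
/-- The map induced by a pointwise inequality of chains. -/
noncomputable def map (h : ∀ a, f.toFun a ≤ g.toFun a) : f.pt ⟶ g.pt :=
  f.desc (fun i hi ↦ g.of i (hi.imp fun a ha ↦ ha.trans (h a)))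
    (fun _ _ h' hj ↦ g.map_comp_of h' (hj.imp fun _ ha ↦ ha.trans (h _)))

variable {f g k} in
lemma of_comp_map (h : ∀ a, f.toFun a ≤ g.toFun a) (i : I) (hi : ∃ a, i ≤ f.toFun a) :
    f.of i hi ≫ map h = g.of i (hi.imp fun a ha ↦ ha.trans (h a)) :=
  f.of_comp_desc _ _ i hi

lemma map_refl : map (fun a ↦ le_refl (f.toFun a)) = 𝟙 f.pt :=
  hom_ext (fun a ↦ by rw [of_comp_map, Category.comp_id])

variable {f g k} in
lemma map_comp_map (h : ∀ a, f.toFun a ≤ g.toFun a) (h' : ∀ a, g.toFun a ≤ k.toFun a) :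
    map h ≫ map h' = map (fun a ↦ (h a).trans (h' a)) :=
  hom_ext (fun a ↦ by
    rw [← Category.assoc, of_comp_map, of_comp_map, of_comp_map])

variable {f g k} in
lemma map_comp_toCarrier (h : ∀ a, f.toFun a ≤ g.toFun a) :
    map h ≫ g.toCarrier = f.toCarrier :=
  hom_ext (fun a ↦ by rw [← Category.assoc, of_comp_map, of_comp_toCarrier, of_comp_toCarrier])

lemma map_comp_str_comp_of {i j : I} (h : i ≤ j) (ht : ∃ a, S.t i j ≤ f.toFun a) :
    J.map (p.diag.map (homOfLE h)) ≫ S.str j ≫ f.of _ (ht.imp fun _ ↦ (S.le_t_right i j).trans) =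
      S.str i ≫ f.of _ (ht.imp fun _ ↦ (S.le_t_left i j).trans) := by
  have h₁ := S.naturality h
  rw [← f.map_comp_of (S.le_t_left _ _) ht, ← f.map_comp_of (S.le_t_right _ _) ht,
    ← reassoc_of% h₁]

lemma isCardinalPresentable_pt [LocallySmall.{w} C] (κ : Cardinal.{w}) [Fact κ.IsRegular]
    (hO : HasCardinalLT O κ) (hp : ∀ i, IsCardinalPresentable (p.diag.obj i) κ) :
    IsCardinalPresentable f.pt κ := by
  have (a : O) : IsCardinalPresentable (f.diag.obj a) κ := hp _
  have hO' : HasCardinalLT (O × O) κ :=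
    hasCardinalLT_prod (Cardinal.IsRegular.aleph0_le Fact.out) hO hO
  exact isCardinalPresentable_of_isColimit _ (colimit.isColimit f.diag) κ
    -- In a linear order an arrow is determined by its endpoints, so the shape has fewer than κ
    -- arrows.
    (hO'.of_injective (fun u : Arrow O ↦ (u.left, u.right)) (fun u v h ↦ by
      obtain ⟨a, b, u⟩ := u
      obtain ⟨a', b', v⟩ := v
      obtain ⟨rfl, rfl⟩ : a = a' ∧ b = b' := by simpa using h
      exact congr_arg (Arrow.mk (f := ·)) (Subsingleton.elim u v)))

variable [PreservesColimitsOfShape O J]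

variable {f} in
lemma map_hom_ext {X : C} {x y : J.obj f.pt ⟶ X}
    (h : ∀ a, J.map (f.of (f.toFun a) ⟨a, le_rfl⟩) ≫ x =
      J.map (f.of (f.toFun a) ⟨a, le_rfl⟩) ≫ y) : x = y :=
  (isColimitOfPreserves J (colimit.isColimit f.diag)).hom_ext (fun a ↦ by
    have := h a
    rw [of_toFun] at this
    exact this)

variable [NoMaxOrder O]

omit [HasColimitsOfShape O C] [PreservesColimitsOfShape O J] in
lemma exists_s_le (a : O) : ∃ b, S.s (f.toFun a) ≤ f.toFun b := by
  obtain ⟨b, hb⟩ := exists_gt a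
  exact ⟨b, f.s_le hb⟩

/-- The structure of algebra on the colimit attached to a chain. -/
noncomputable def str : J.obj f.pt ⟶ f.pt :=
  (isColimitOfPreserves J (colimit.isColimit f.diag)).desc (Cocone.mk f.pt
    { app a := S.str (f.toFun a) ≫ f.of _ (f.exists_s_le a)
      naturality a b φ := by
        -- Closure under `t` only holds strictly later, hence the absence of a maximum in `O`.
        obtain ⟨c, hc⟩ := exists_gt (max a b)
        exact (f.map_comp_str_comp_of (f.mono (leOfHom φ))
          ⟨c, f.t_le ((le_max_left _ _).trans_lt hc) ((le_max_right _ _).trans_lt hc)⟩).trans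
          (Category.comp_id _).symm })

lemma map_of_comp_str (a : O) :
    J.map (f.of (f.toFun a) ⟨a, le_rfl⟩) ≫ f.str =
      S.str (f.toFun a) ≫ f.of _ (f.exists_s_le a) := by
  rw [of_toFun]
  exact (isColimitOfPreserves J (colimit.isColimit f.diag)).fac _ a

lemma unit_comp_str : ι.app f.pt ≫ f.str = 𝟙 f.pt :=
  hom_ext (fun a ↦ by
    have h : f.of (f.toFun a) ⟨a, le_rfl⟩ ≫ ι.app f.pt =
      ι.app (p.diag.obj (f.toFun a)) ≫ J.map (f.of (f.toFun a) ⟨a, le_rfl⟩) := ι.naturality _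
    have h' := S.unit_str (f.toFun a)
    rw [reassoc_of% h, map_of_comp_str, reassoc_of% h', map_comp_of, Category.comp_id])

/-- The algebra attached to a chain. -/
noncomputable abbrev algebra : PointedAlgebra J ι := .mk f.pt f.str f.unit_comp_str

/-- The morphism from the algebra attached to a chain. -/
noncomputable def algebraHom : f.algebra ⟶ A :=
  homMk f.toCarrier (map_hom_ext (fun a ↦ by
    rw [← J.map_comp_assoc, of_comp_toCarrier, ← Category.assoc, map_of_comp_str,
      Category.assoc, of_comp_toCarrier, S.str_comp_ι]))

/-- The preorder on chains for which the inequalities are the pointwise inequalities that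
induce a morphism of algebras. -/
instance : Preorder (S.Chain O) where
  le f g := ∃ (h : ∀ a, f.toFun a ≤ g.toFun a), J.map (map h) ≫ g.str = f.str ≫ map h
  le_refl f := ⟨fun _ ↦ le_rfl, by rw [map_refl, J.map_id, Category.id_comp, Category.comp_id]⟩
  le_trans f g k := by
    rintro ⟨h, hh⟩ ⟨h', hh'⟩
    refine ⟨fun a ↦ (h a).trans (h' a), ?_⟩
    rw [← map_comp_map h h', J.map_comp, Category.assoc, hh', reassoc_of% hh]

variable {f g k} in
-- The approximate structures on `f a` and `g a` agree after index `t (f a) (g a)`. If `g` goes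
-- beyond it, they agree in the colimit of `g`.
lemma le_of_t_le (h : ∀ a, f.toFun a ≤ g.toFun a)
    (ht : ∀ a, ∃ b, S.t (f.toFun a) (g.toFun a) ≤ g.toFun b) : f ≤ g :=
  ⟨h, map_hom_ext (fun a ↦ by
    rw [← J.map_comp_assoc, of_comp_map, ← Category.assoc, map_of_comp_str, Category.assoc,
      of_comp_map, ← g.map_comp_of (h a) ⟨a, le_rfl⟩, J.map_comp, Category.assoc,
      map_of_comp_str, g.map_comp_str_comp_of (h a) (ht a)])⟩

end Chain

end StrApprox

end PointedAlgebra

/-! ### Recursion, bounds and strong generators -/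

lemma WellFoundedLT.exists_forall_rel {O : Type*} [LT O] [WellFoundedLT O] {I : Type*}
    (r : ∀ a : O, (∀ b < a, I) → I → Prop) (hr : ∀ a x, ∃ i, r a x i) :
    ∃ f : O → I, ∀ a, r a (fun b _ ↦ f b) (f a) := by
  choose F hF using hr
  refine ⟨wellFounded_lt.fix F, fun a ↦ ?_⟩
  have h := hF a (fun b _ ↦ wellFounded_lt.fix F b)
  rwa [← wellFounded_lt.fix_eq F a] at h

lemma CategoryTheory.IsCardinalFiltered.exists_forall_le {I : Type*} [Preorder I]
    (κ : Cardinal.{w}) [Fact κ.IsRegular] [IsCardinalFiltered I κ] {K : Type*} (f : K → I)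
    (hK : HasCardinalLT K κ) : ∃ i, ∀ k, f k ≤ i :=
  ⟨_, fun k ↦ leOfHom (toMax f hK k)⟩

/-- Maps out of `F Z` are maps from `Z` into `G`, so separation and detection of isomorphisms are
checked after applying `G`. -/
lemma CategoryTheory.Adjunction.isStrongGenerator_strictMap {C : Type u₁} [Category.{v₁} C]
    {D : Type u₂} [Category.{v₂} D] {F : C ⥤ D} {G : D ⥤ C} (adj : F ⊣ G) [G.Faithful]
    [G.ReflectsIsomorphisms] {P : ObjectProperty C} (hP : P.IsStrongGenerator) :
    (P.strictMap F).IsStrongGenerator := by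
  rw [ObjectProperty.isStrongGenerator_iff]
  refine ⟨fun A B f g h ↦ G.map_injective (hP.isSeparating _ _ fun Z hZ x ↦ ?_),
    fun A B i _ hi ↦ ?_⟩
  · have := h (F.obj Z) ⟨Z, hZ⟩ ((adj.homEquiv _ _).symm x)
    rw [← adj.homEquiv_naturality_right_symm, ← adj.homEquiv_naturality_right_symm] at this
    exact (adj.homEquiv _ _).symm.injective this
  · have := adj.isRightAdjoint
    have : IsIso (G.map i) := hP.isIso_of_mono _ (fun Z hZ x ↦ by
      obtain ⟨y, hy⟩ := hi (F.obj Z) ⟨Z, hZ⟩ ((adj.homEquiv _ _).symm x)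
      exact ⟨adj.homEquiv _ _ y, by
        dsimp only at hy ⊢
        rw [← adj.homEquiv_naturality_right, hy, Equiv.apply_symm_apply]⟩)
    exact isIso_of_reflects_iso i G

/-! ### Filteredness of chains and their colimit -/

namespace PointedAlgebra.StrApprox

open Limits

variable {C : Type u₁} [Category.{v₁} C] {J : C ⥤ C} {ι : 𝟭 C ⟶ J}
  {A : PointedAlgebra J ι} {I : Type w} [PartialOrder I]
  {p : ColimitPresentation I A.obj.a} (S : StrApprox p)
  (O : Type w) [LinearOrder O] [NoMaxOrder O]
  [HasColimitsOfShape O C] [PreservesColimitsOfShape O J]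
  (κ : Cardinal.{w}) [Fact κ.IsRegular] [IsCardinalFiltered I κ] (hO : HasCardinalLT O κ)

include hO

variable {O}

/-- The index `g a` is chosen recursively above fewer than κ constraints: the earlier values of `g`,
their `t`-values, all `f k a`, and `t (f k b) (g b)` for `b < a`. The last family makes `f k ⟶ g` an
algebra morphism. The index `i₀` ensures that every `X i` occurs in some chain. -/
lemma exists_chain_ge [WellFoundedLT O] (i₀ : I) {K : Type w} (f : K → S.Chain O) (hK : HasCardinalLT K κ) :
    ∃ g : S.Chain O, (∀ a, i₀ ≤ g.toFun a) ∧ ∀ k, f k ≤ g := by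
  have hκ : Cardinal.aleph0 ≤ κ := Cardinal.IsRegular.aleph0_le Fact.out
  have := isFiltered_of_isCardinalFiltered I κ
  have hlt (a : O) : HasCardinalLT {b // b < a} κ :=
    hO.of_injective _ Subtype.val_injective
  obtain ⟨g, hg⟩ := WellFoundedLT.exists_forall_rel
    (r := fun (a : O) (x : ∀ b < a, I) (i : I) ↦ i₀ ≤ i ∧ (∀ b hb, x b hb ≤ i) ∧
      (∀ b hb c hc, S.t (x b hb) (x c hc) ≤ i) ∧ (∀ k, (f k).toFun a ≤ i) ∧
      (∀ k b hb, S.t ((f k).toFun b) (x b hb) ≤ i)) (fun a x ↦ by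
    obtain ⟨i₁, h₁⟩ := IsCardinalFiltered.exists_forall_le κ
      (fun b : {b // b < a} ↦ x b.1 b.2) (hlt a)
    obtain ⟨i₂, h₂⟩ := IsCardinalFiltered.exists_forall_le κ
      (fun b : {b // b < a} × {b // b < a} ↦ S.t (x b.1.1 b.1.2) (x b.2.1 b.2.2))
      (hasCardinalLT_prod hκ (hlt a) (hlt a))
    obtain ⟨i₃, h₃⟩ := IsCardinalFiltered.exists_forall_le κ (fun k ↦ (f k).toFun a) hK
    obtain ⟨i₄, h₄⟩ := IsCardinalFiltered.exists_forall_le κ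
      (fun b : K × {b // b < a} ↦ S.t ((f b.1).toFun b.2.1) (x b.2.1 b.2.2))
      (hasCardinalLT_prod hκ hK (hlt a))
    obtain ⟨i, hi⟩ := IsCardinalFiltered.exists_forall_le κ ![i₀, i₁, i₂, i₃, i₄]
      (hasCardinalLT_of_finite _ _ hκ)
    exact ⟨i, hi 0, fun b hb ↦ (h₁ ⟨b, hb⟩).trans (hi 1),
      fun b hb c hc ↦ (h₂ (⟨b, hb⟩, ⟨c, hc⟩)).trans (hi 2), fun k ↦ (h₃ k).trans (hi 3),
      fun k b hb ↦ (h₄ (k, ⟨b, hb⟩)).trans (hi 4)⟩)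
  choose h₀ h₁ h₂ h₃ h₄ using hg
  refine ⟨{
    toFun := g
    mono {a b} h := h.lt_or_eq.elim (fun h ↦ h₁ b a h) (fun h ↦ (congr_arg g h).le)
    t_le {a b c} hac hbc := h₂ c a hac b hbc }, h₀, fun k ↦ ?_⟩
  refine Chain.le_of_t_le (fun a ↦ h₃ a k) (fun a ↦ ?_)
  obtain ⟨b, hb⟩ := exists_gt a
  exact ⟨b, h₄ b k a hb⟩

lemma isCardinalFiltered_chain [WellFoundedLT O] : IsCardinalFiltered (S.Chain O) κ :=
  isCardinalFiltered_preorder _ _ (fun K f hK ↦ by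
    have := isFiltered_of_isCardinalFiltered I κ
    obtain ⟨g, -, hg⟩ := S.exists_chain_ge κ hO IsFiltered.nonempty.some f
      (by rwa [hasCardinalLT_iff_cardinal_mk_lt])
    exact ⟨g, hg⟩)

omit hO

variable (O)

/-- The functor which sends a chain to the corresponding algebra. -/
noncomputable def chainFunctor : S.Chain O ⥤ PointedAlgebra J ι where
  obj f := f.algebra
  map φ := homMk (Chain.map (leOfHom φ).choose) (leOfHom φ).choose_spec
  map_id f := PointedAlgebra.hom_ext f.map_refl
  map_comp φ ψ := PointedAlgebra.hom_ext (Chain.map_comp_map (leOfHom φ).choose (leOfHom ψ).choose).symm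

/-- The cocone with point `A` given by the algebras attached to chains. -/
noncomputable def chainCocone : Cocone (S.chainFunctor O) where
  pt := A
  ι :=
    { app f := f.algebraHom
      naturality _ _ φ := PointedAlgebra.hom_ext
        ((Chain.map_comp_toCarrier (leOfHom φ).choose).trans (Category.comp_id _).symm) }

section

variable {S O} (s : Cocone (S.chainFunctor O ⋙ forget J ι))

/-- The component on the algebra attached to a chain of a cocone. -/
def coconeApp (f : S.Chain O) : f.pt ⟶ s.pt := s.ι.app f

lemma map_comp_coconeApp {f g : S.Chain O} (h : f ≤ g) :
    Chain.map h.choose ≫ coconeApp s g = coconeApp s f :=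
  s.w (homOfLE h)

lemma of_comp_coconeApp_of_le {f g : S.Chain O} (h : f ≤ g) (i : I) (hf : ∃ a, i ≤ f.toFun a)
    (hg : ∃ a, i ≤ g.toFun a) :
    f.of i hf ≫ coconeApp s f = g.of i hg ≫ coconeApp s g := by
  rw [← map_comp_coconeApp s h, ← Category.assoc, Chain.of_comp_map]

/-- A cocone on chains thus induces a well-defined map on each `X i`, by comparison in a common
upper bound. -/
lemma of_comp_coconeApp [IsDirectedOrder (S.Chain O)] (f g : S.Chain O) (i : I)
    (hf : ∃ a, i ≤ f.toFun a) (hg : ∃ a, i ≤ g.toFun a) :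
    f.of i hf ≫ coconeApp s f = g.of i hg ≫ coconeApp s g := by
  obtain ⟨k, hfk, hgk⟩ := exists_ge_ge f g
  have hk : ∃ a, i ≤ k.toFun a := hf.imp fun _ ha ↦ ha.trans (hfk.choose _)
  rw [of_comp_coconeApp_of_le s hfk i hf hk, of_comp_coconeApp_of_le s hgk i hg hk]

end

variable {O} in
include hO in
lemma nonempty_isColimit_chainCocone [WellFoundedLT O] [Nonempty O] :
    Nonempty (IsColimit ((forget J ι).mapCocone (S.chainCocone O))) := by
  have := S.isCardinalFiltered_chain κ hO
  have := isFiltered_of_isCardinalFiltered (S.Chain O) κ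
  have := IsFiltered.isDirectedOrder (S.Chain O)
  have hfac (f : S.Chain O) (i : I) (hf : ∃ a, i ≤ f.toFun a) :
      f.of i hf ≫ f.toCarrier = p.ι.app i := f.of_comp_toCarrier i hf
  have H (i : I) : ∃ f : S.Chain O, ∃ a, i ≤ f.toFun a := by
    -- With no chains to dominate, only the requirement of lying above `i` remains.
    obtain ⟨f, hf, -⟩ := S.exists_chain_ge κ hO i (K := PEmpty) (fun k ↦ k.elim)
      (hasCardinalLT_of_finite _ _ (Cardinal.IsRegular.aleph0_le Fact.out))
    exact ⟨f, Classical.arbitrary O, hf _⟩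
  choose f hf using H
  let d (s : Cocone (S.chainFunctor O ⋙ forget J ι)) : A.obj.a ⟶ s.pt :=
    p.isColimit.desc (Cocone.mk s.pt
      { app i := (f i).of i (hf i) ≫ coconeApp s (f i)
        naturality i j φ := by
          have h := (f j).map_comp_of (leOfHom φ) (hf j)
          refine (Category.assoc _ _ _).symm.trans ((h =≫ coconeApp s (f j)).trans ?_)
          exact (of_comp_coconeApp s _ _ _ _ _).trans (Category.comp_id _).symm })
  have hd (s) (i : I) : p.ι.app i ≫ d s = (f i).of i (hf i) ≫ coconeApp s (f i) :=
    p.isColimit.fac _ i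
  exact ⟨{
    desc := d
    fac s g := by
      refine Chain.hom_ext (f := g) (y := coconeApp s g) (fun a ↦ ?_)
      refine (Category.assoc _ _ _).symm.trans ((hfac g _ ⟨a, le_rfl⟩ =≫ d s).trans ?_)
      exact (hd s _).trans (of_comp_coconeApp s _ _ _ _ _)
    uniq s m hm := p.isColimit.hom_ext (fun i ↦ by
      refine Eq.trans ?_ (hd s i).symm
      refine ((hfac (f i) i (hf i)).symm =≫ m).trans ((Category.assoc _ _ _).trans ?_)
      exact whisker_eq _ (hm (f i))) }⟩

end PointedAlgebra.StrApprox

/-! ### Algebras with presentable carrier generate; the main theorem -/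

namespace PointedAlgebra

open Limits

variable {C : Type u₁} [Category.{v₁} C] (J : C ⥤ C) (ι : 𝟭 C ⟶ J)

/-- The property that the carrier of an algebra is `κ`-presentable. -/
def hasPresentableCarrier (κ : Cardinal.{w}) [Fact κ.IsRegular] :
    ObjectProperty (PointedAlgebra J ι) :=
  (isCardinalPresentable C κ).inverseImage (forget J ι)

lemma isCardinalFilteredGenerator_hasPresentableCarrier
    (κ lam : Cardinal.{w}) [Fact κ.IsRegular] [Fact lam.IsRegular] (hκ : κ < lam)
    [IsCardinalLocallyPresentable C lam] [J.IsCardinalAccessible κ]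
    (hJ : ∀ X : C, IsCardinalPresentable X lam → IsCardinalPresentable (J.obj X) lam) :
    (hasPresentableCarrier J ι lam).IsCardinalFilteredGenerator lam where
  le_isCardinalPresentable A (hA : IsCardinalPresentable A.obj.a lam) := by
    have := hJ _ hA
    have := J.isCardinalAccessible_of_le hκ.le
    exact isCardinalPresentable_of_forget lam A
  exists_colimitsOfShape A := by
    obtain ⟨P, _, hP⟩ := HasCardinalFilteredGenerator.exists_generator C lam
    obtain ⟨K, _, _, hK⟩ := hP.exists_colimitsOfShape A.obj.a
    obtain ⟨I, _, _, F, _⟩ := IsCardinalFiltered.exists_cardinal_directed K lam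
    obtain ⟨p⟩ := P.colimitsOfShape_le_of_final F _ hK
    have hp (i : I) : IsCardinalPresentable (p.diag.obj i) lam :=
      hP.le_isCardinalPresentable _ (p.prop_diag_obj i)
    obtain ⟨S⟩ := nonempty_strApprox p.toColimitPresentation lam hp (fun i ↦ hJ _ (hp i))
    -- The ordinal κ is κ-filtered, so `J` preserves colimits of this shape, and has cardinality κ <
    -- `lam`, so these colimits keep `lam`-presentability.
    let O := κ.ord.ToType
    have hκ' : Cardinal.aleph0 ≤ κ := Cardinal.IsRegular.aleph0_le Fact.out
    have : NoMaxOrder O := Cardinal.noMaxOrder hκ'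
    have : Nonempty O := IsCardinalFiltered.nonempty O κ
    have := J.preservesColimitsOfShape_of_isCardinalAccessible κ O
    have hO : HasCardinalLT O lam := by
      simpa [hasCardinalLT_iff_cardinal_mk_lt, O] using hκ
    have := S.isCardinalFiltered_chain lam hO
    have := J.isCardinalAccessible_of_le hκ.le
    have := J.preservesColimitsOfShape_of_isCardinalAccessible lam (S.Chain O)
    obtain ⟨hc⟩ := S.nonempty_isColimit_chainCocone lam hO
    exact ⟨S.Chain O, inferInstance, inferInstance, ⟨{
      diag := S.chainFunctor O
      ι := (S.chainCocone O).ι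
      isColimit := isColimitOfForget hc
      prop_diag_obj f := f.isCardinalPresentable_pt lam hO hp }⟩⟩

end PointedAlgebra

theorem mainTheorem10 {C : Type u₁} [Category.{v₁} C]
    (κ lam : Cardinal.{w}) [Fact κ.IsRegular] [Fact lam.IsRegular] (hκ : κ < lam)
    [IsCardinalLocallyPresentable C lam]
    (J : C ⥤ C) (ι : 𝟭 C ⟶ J)
    (hJ : J.IsCardinalAccessible κ)
    (hJlam : IsStronglyCardinalAccessible J lam) :
    -- the free `(J, ι)`-algebra functor exists, so that the induced monad is defined
    (PointedAlgebra.forget J ι).IsRightAdjoint ∧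
    -- (i), for the monad induced by the free-forgetful adjunction (for any choice of it)
    (∀ (F : C ⥤ PointedAlgebra J ι) (adj : F ⊣ PointedAlgebra.forget J ι),
      adj.toMonad.toFunctor.IsCardinalAccessible κ ∧
      IsStronglyCardinalAccessible adj.toMonad.toFunctor lam) ∧
    -- (ii)
    IsCardinalLocallyPresentable (PointedAlgebra J ι) lam ∧
    -- (iii)
    IsStronglyCardinalAccessible (PointedAlgebra.forget J ι) lam := by
  have := hJlam.preserves
  have hgen := PointedAlgebra.isCardinalFilteredGenerator_hasPresentableCarrier J ι κ lam hκ
    hJlam.presentable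
  have hcolim := PointedAlgebra.hasColimitsOfSize.{w} J ι lam
  have hadj := PointedAlgebra.isRightAdjoint_forget J ι lam
  have hUκ := PointedAlgebra.isCardinalAccessible_forget (J := J) (ι := ι) κ
  have hU := PointedAlgebra.isCardinalAccessible_forget (J := J) (ι := ι) lam
  have hpres (A : PointedAlgebra J ι) (hA : IsCardinalPresentable A lam) :
      IsCardinalPresentable ((PointedAlgebra.forget J ι).obj A) lam := by
    have hA' : isCardinalPresentable _ lam A := hA
    -- A presentable algebra is a retract of one with presentable carrier, and `U` preserves
    -- retracts.
    rw [hgen.isPresentable_eq_retractClosure] at hA'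
    obtain ⟨B, hB, ⟨r⟩⟩ := hA'
    have : IsCardinalPresentable ((PointedAlgebra.forget J ι).obj B) lam := hB
    exact (r.map (PointedAlgebra.forget J ι)).isCardinalPresentable lam
  have hloc : IsCardinalLocallyPresentable (PointedAlgebra J ι) lam := by
    have := locallySmall_of_faithful.{w} (PointedAlgebra.forget J ι)
    obtain ⟨P, _, hP⟩ := HasCardinalFilteredGenerator.exists_small_generator C lam
    rw [IsCardinalLocallyPresentable.iff_exists_isStrongGenerator]
    let adj := Adjunction.ofIsRightAdjoint (PointedAlgebra.forget J ι)
    -- Free algebras on a small generator form a small strong generator, presentable because `U` is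
    -- accessible.
    refine ⟨_, inferInstance, adj.isStrongGenerator_strictMap hP.isStrongGenerator, ?_⟩
    rintro _ ⟨X, hX⟩
    have : IsCardinalPresentable X lam := hP.le_isCardinalPresentable _ hX
    exact adj.isCardinalPresentable_leftAdjoint_obj lam X
  refine ⟨hadj, fun F adj ↦ ⟨?_, ?_, ?_, ?_, fun X hX ↦ ?_⟩, hloc, ?_, ?_, hU, hpres⟩
  · have := adj.isLeftAdjoint
    exact inferInstanceAs ((F ⋙ PointedAlgebra.forget J ι).IsCardinalAccessible κ)
  · infer_instance
  · infer_instance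
  · have := adj.isLeftAdjoint
    exact inferInstanceAs ((F ⋙ PointedAlgebra.forget J ι).IsCardinalAccessible lam)
  · exact hpres _ (adj.isCardinalPresentable_leftAdjoint_obj lam X)
  · infer_instance
  · infer_instance
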